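/- For a Lebesgue measurable set $A\subseteq\mathbb{R}^n$ let $|A|$ denote its volume, let $D_n$ be the closed Euclidean unit ball of $\mathbb{R}^n$ centred at the origin, and let $\Delta_v(A,B)=|A\,\triangle\,B|$ be the symmetric volume difference. A polytope in $\mathbb{R}^n$ is a bounded intersection of finitely many closed half-spaces with nonempty interior, and its facets are its $(n-1)$-dimensional faces. There is an absolute constant $C>0$ such that for all integers $n\ge 2$ and $N\ge 10^n$ there exists a polytope $P$ in $\mathbb{R}^n$ with at most $N$ facets satisfying \[ \Delta_v(D_n,P)\;\le\; C\,N^{-\frac{2}{n-1}}\,|D_n| . \] Consequently, every polytope $P^b_{n,N}$ that minimizes $\Delta_v(D_n,\cdot)$ among all polytopes in $\mathbb{R}^n$ with at most $N$ facets satisfies $\Delta_v(D_n,P^b_{n,N})\le C\,N^{-\frac{2}{n-1}}\,|D_n|$. -/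

import Mathlib

open scoped symmDiff

namespace BallApprox

/-- The centred closed Euclidean unit ball `D_n` of `ℝⁿ`. -/
def unitBall (n : ℕ) : Set (EuclideanSpace ℝ (Fin n)) :=
  Metric.closedBall 0 1

/-- The symmetric volume difference `Δ_v(A, B)`, the Lebesgue measure of `A ∆ B`. -/
noncomputable def symmVolDiff {n : ℕ} (A B : Set (EuclideanSpace ℝ (Fin n))) : ℝ :=
  MeasureTheory.volume.real (A ∆ B)

/-- A (full-dimensional) convex polytope in `ℝⁿ`: a bounded intersection of finitely many closed
half-spaces `{x | ⟪a, x⟫ ≤ b}`, `a ≠ 0`, with nonempty interior. -/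
structure IsPolytope {n : ℕ} (P : Set (EuclideanSpace ℝ (Fin n))) : Prop where
  exists_halfSpaces : ∃ s : Finset (EuclideanSpace ℝ (Fin n) × ℝ),
    (∀ p ∈ s, p.1 ≠ 0) ∧ P = {x | ∀ p ∈ s, inner ℝ p.1 x ≤ p.2}
  isBounded : Bornology.IsBounded P
  nonempty_interior : (interior P).Nonempty

/-- A facet of `P ⊆ ℝⁿ`: a nonempty exposed face of dimension `n - 1`. -/
structure IsFacet {n : ℕ} (P F : Set (EuclideanSpace ℝ (Fin n))) : Prop where
  isExposed : IsExposed ℝ P F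
  nonempty : F.Nonempty
  finrank_add_one : Module.finrank ℝ (vectorSpan ℝ F) + 1 = n

/-- `P` is a polytope in `ℝⁿ` with at most `N` facets (the facets are counted in `ℕ∞`). -/
def IsPolytopeWithFacetsLE {n : ℕ} (N : ℕ) (P : Set (EuclideanSpace ℝ (Fin n))) : Prop :=
  IsPolytope P ∧ {F | IsFacet P F}.encard ≤ N

/-- `P` is best-approximating for `D_n`, with respect to the symmetric volume difference, among
all polytopes with at most `N` facets. -/
def IsBestApproximating {n : ℕ} (N : ℕ) (P : Set (EuclideanSpace ℝ (Fin n))) : Prop :=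
  IsPolytopeWithFacetsLE N P ∧
    ∀ Q : Set (EuclideanSpace ℝ (Fin n)), IsPolytopeWithFacetsLE N Q →
      symmVolDiff (unitBall n) P ≤ symmVolDiff (unitBall n) Q

end BallApprox

/-!
The approximating polytope is random. Write `n = m + 1`, let `κ` denote volumes of unit balls, and cut
`ℝⁿ` by `M ≥ N/2` half-spaces `⟪ξᵢ, x⟫ ≤ t‖ξᵢ‖` with `ξᵢ` independent and uniform in the unit ball.
The hyperplanes cut the ball in discs of radius `w₀ = √(1 - t²)`, and `w₀` is calibrated by
`M κₘ w₀ᵐ = n κₙ`. Since `κₙ ≤ 2 κₘ`, this gives `w₀² ≤ 64 N^(-2/m)` (`exists_approximating_polytope`),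
so it suffices to show that both parts of the symmetric difference have volume `O(w₀² κₙ)`.

The part of the ball lost is at most `M` caps, whatever the directions. A cap has volume at most
`κₘ w₀^(m+2) / (t (m+2))` (`volume_cap_le`), and the calibration turns `M` times this into at most
`κₙ w₀² / t` (`volume_ball_diff_cuts_le`).

A point at distance `r > 1` is cut off by one half-space with probability the relative volume of a
circular cone of cosine `s = t/r` in the ball. Such a cone contains a straight cone of height `s` over
a disc of radius `w = √(1 - s²)` (`le_volume_cone`), so the point survives all cuts with probability at
most `exp (-s (w/w₀)ᵐ)`, where `(w/w₀)² ≥ 1 + a (r - 1)` and `a = t²/w₀²` (`survival_le`). In polar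
coordinates the expected excess volume is then `O(κₙ / a)` (`lintegral_shell_le`): the double
exponential decay beats the Jacobian `rᵐ` on the scale `r - 1 ≈ 1/(a m)`, uniformly in `m`. Some
outcome is at least as good as the expectation (`exists_volume_inter_le`).

The integration is confined to `r ≤ 8/7`, and boundedness is ensured, by adding the half-spaces tangent
to the ball along a `1/2`-net of the sphere with at most `5ⁿ ≤ N/2` points (`exists_net`). Finally, a
polytope given by `N` half-spaces has at most `N` facets (`encard_facets_le`), and a best
approximating polytope is at least as good as the one constructed.
-/

open MeasureTheory

namespace BallApprox

/-! ### Facets of an intersection of half-spaces -/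

variable {n : ℕ}

theorem convex_halfSpaces (s : Finset (EuclideanSpace ℝ (Fin n) × ℝ)) :
    Convex ℝ {x : EuclideanSpace ℝ (Fin n) | ∀ p ∈ s, inner ℝ p.1 x ≤ p.2} := by
  intro x hx y hy a b ha hb hab p hp
  have h1 := mul_le_mul_of_nonneg_left (hx p hp) ha
  have h2 := mul_le_mul_of_nonneg_left (hy p hp) hb
  rw [inner_add_right, inner_smul_right, inner_smul_right]
  calc _ ≤ a * p.2 + b * p.2 := add_le_add h1 h2
    _ = p.2 := by rw [← add_mul, hab, one_mul]

/-- If no single hyperplane of a finite family of supporting hyperplanes contains the convex set `F`,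
then some point of `F` lies off all of them: average the individual witnesses. -/
theorem exists_strict_of_forall_exists {F : Set (EuclideanSpace ℝ (Fin n))} (hF : Convex ℝ F)
    (hne : F.Nonempty) (s : Finset (EuclideanSpace ℝ (Fin n) × ℝ))
    (hle : ∀ x ∈ F, ∀ p ∈ s, inner ℝ p.1 x ≤ p.2)
    (h : ∀ p ∈ s, ∃ x ∈ F, inner ℝ p.1 x ≠ p.2) :
    ∃ x ∈ F, ∀ p ∈ s, inner ℝ p.1 x < p.2 := by
  classical
  induction s using Finset.induction_on with
  | empty => exact ⟨hne.some, hne.some_mem, by simp⟩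
  | insert q s _ ih =>
    obtain ⟨x, hx, hxs⟩ := ih (fun x hx p hp => hle x hx p (Finset.mem_insert_of_mem hp))
      (fun p hp => h p (Finset.mem_insert_of_mem hp))
    obtain ⟨y, hy, hyq⟩ := h q (Finset.mem_insert_self _ _)
    refine ⟨(1 / 2 : ℝ) • x + (1 / 2 : ℝ) • y,
      hF hx hy (by norm_num) (by norm_num) (by norm_num), fun p hp => ?_⟩
    rw [inner_add_right, inner_smul_right, inner_smul_right]
    have hx1 := hle x hx p hp
    have hy1 := hle y hy p hp
    rcases Finset.mem_insert.1 hp with rfl | hp'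
    · have := lt_of_le_of_ne hy1 hyq
      linarith
    · have := hxs p hp'
      linarith

/-- Each facet of `{x | ∀ p ∈ s, ⟪p.1, x⟫ ≤ p.2}` is cut out by the bounding hyperplane of one of the
half-spaces. -/
theorem IsFacet.exists_eq {s : Finset (EuclideanSpace ℝ (Fin n) × ℝ)}
    (hs : ∀ p ∈ s, p.1 ≠ 0) {P F : Set (EuclideanSpace ℝ (Fin n))}
    (hP : P = {x | ∀ p ∈ s, inner ℝ p.1 x ≤ p.2}) (hint : (interior P).Nonempty)
    (hF : IsFacet P F) :
    ∃ p ∈ s, F = {x ∈ P | inner ℝ p.1 x = p.2} := by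
  obtain ⟨l, hl⟩ := hF.isExposed hF.nonempty
  have hFP : F ⊆ P := hF.isExposed.subset
  have hPc : Convex ℝ P := hP ▸ convex_halfSpaces s
  have hmem : ∀ x ∈ P, ∀ p ∈ s, inner ℝ p.1 x ≤ p.2 := fun x hx => by rw [hP] at hx; exact hx
  -- A vanishing functional exposes the whole of `P`, which has dimension `n`.
  have hl0 : l ≠ 0 := by
    rintro rfl
    have hFP' : F = P := by rw [hl]; ext x; simp
    have htop : vectorSpan ℝ P = ⊤ := by
      rw [← direction_affineSpan, ((hPc.interior_nonempty_iff_affineSpan_eq_top).1 hint),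
        AffineSubspace.direction_top]
    have := hF.finrank_add_one
    rw [hFP', htop, finrank_top, finrank_euclideanSpace_fin] at this
    omega
  have hconst : ∀ x ∈ F, ∀ y ∈ F, l x = l y := fun x hx y hy => by
    rw [hl] at hx hy
    exact le_antisymm (hy.2 x hx.1) (hx.2 y hy.1)
  obtain ⟨p, hp, hpF⟩ : ∃ p ∈ s, ∀ x ∈ F, inner ℝ p.1 x = p.2 := by
    by_contra! hcon
    obtain ⟨x, hx, hxs⟩ := exists_strict_of_forall_exists (hF.isExposed.convex hPc) hF.nonempty s
      (fun x hx => hmem x (hFP hx)) hcon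
    have hopen : IsOpen {y : EuclideanSpace ℝ (Fin n) | ∀ p ∈ s, inner ℝ p.1 y < p.2} := by
      have : {y : EuclideanSpace ℝ (Fin n) | ∀ p ∈ s, inner ℝ p.1 y < p.2}
          = ⋂ p ∈ s, {y | inner ℝ p.1 y < p.2} := by ext; simp
      rw [this]
      exact isOpen_biInter_finset fun p _ => isOpen_lt (by fun_prop) continuous_const
    -- The linear functional `l` would have a local maximum at `x`.
    have hmax : IsLocalMax l x := by
      filter_upwards [hopen.mem_nhds hxs] with y hy
      rw [hl] at hx
      exact hx.2 y (by rw [hP]; exact fun p hp => (hy p hp).le)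
    exact hl0 (hmax.hasFDerivAt_eq_zero l.hasFDerivAt)
  refine ⟨p, hp, Set.Subset.antisymm (fun x hx => ⟨hFP hx, hpF x hx⟩) fun y hy => ?_⟩
  obtain ⟨x, hx⟩ := hF.nonempty
  have hn : Fact (Module.finrank ℝ (EuclideanSpace ℝ (Fin n)) =
      Module.finrank ℝ (vectorSpan ℝ F) + 1) :=
    ⟨by rw [hF.finrank_add_one, finrank_euclideanSpace_fin]⟩
  have hsub : vectorSpan ℝ F ≤ (ℝ ∙ p.1)ᗮ := by
    rw [vectorSpan_def, Submodule.span_le]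
    rintro _ ⟨a, ha, b, hb, rfl⟩
    simp only [SetLike.mem_coe, Submodule.mem_orthogonal_singleton_iff_inner_right, vsub_eq_sub,
      inner_sub_right, hpF a ha, hpF b hb, sub_self]
  -- Both spaces have dimension `n - 1`, so `l` vanishes on all of `p.1ᗮ`, not only along `F`.
  have heq : vectorSpan ℝ F = (ℝ ∙ p.1)ᗮ :=
    Submodule.eq_of_le_of_finrank_eq hsub
      (Submodule.finrank_orthogonal_span_singleton (𝕜 := ℝ) (hs p hp)).symm
  have hker : vectorSpan ℝ F ≤ LinearMap.ker l.toLinearMap := by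
    rw [vectorSpan_def, Submodule.span_le]
    rintro _ ⟨a, ha, b, hb, rfl⟩
    simp [hconst a ha b hb]
  have hyx : y - x ∈ vectorSpan ℝ F := by
    rw [heq, Submodule.mem_orthogonal_singleton_iff_inner_right, inner_sub_right, hy.2, hpF x hx,
      sub_self]
  have hlyx : l y = l x := by
    have := hker hyx
    simpa [sub_eq_zero] using this
  rw [hl] at hx ⊢
  exact ⟨hy.1, fun z hz => by rw [hlyx]; exact hx.2 z hz⟩

/-- An intersection of finitely many half-spaces has at most as many facets as half-spaces, since a
facet is determined by any bounding hyperplane that contains it. -/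
theorem encard_facets_le {s : Finset (EuclideanSpace ℝ (Fin n) × ℝ)} (hs : ∀ p ∈ s, p.1 ≠ 0)
    {P : Set (EuclideanSpace ℝ (Fin n))} (hP : P = {x | ∀ p ∈ s, inner ℝ p.1 x ≤ p.2})
    (hint : (interior P).Nonempty) :
    {F | IsFacet P F}.encard ≤ s.card := by
  have hsub : {F | IsFacet P F} ⊆
      (fun p : EuclideanSpace ℝ (Fin n) × ℝ => {x ∈ P | inner ℝ p.1 x = p.2}) '' s := by
    intro F hF
    obtain ⟨p, hp, h⟩ := hF.exists_eq hs hP hint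
    exact ⟨p, hp, h.symm⟩
  calc _ ≤ _ := Set.encard_le_encard hsub
    _ ≤ (s : Set (EuclideanSpace ℝ (Fin n) × ℝ)).encard := Set.encard_image_le _ _
    _ = s.card := Set.encard_coe_eq_coe_finsetCard s

/-! ### Volumes of caps and cones -/

/-- The last `m` coordinates of a point of `ℝ^(m+1)`. -/
def tail {m : ℕ} (x : EuclideanSpace ℝ (Fin (m + 1))) : EuclideanSpace ℝ (Fin m) :=
  WithLp.toLp 2 fun i => x i.succ

theorem norm_sq_eq_head_add_tail {m : ℕ} (x : EuclideanSpace ℝ (Fin (m + 1))) :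
    ‖x‖ ^ 2 = x 0 ^ 2 + ‖tail x‖ ^ 2 := by
  simp [EuclideanSpace.real_norm_sq_eq, Fin.sum_univ_succ, tail]

theorem measurePreserving_head_tail (m : ℕ) :
    MeasurePreserving (fun x : EuclideanSpace ℝ (Fin (m + 1)) => (x 0, tail x)) := by
  have h1 := EuclideanSpace.volume_preserving_symm_measurableEquiv_toLp (Fin (m + 1))
  have h2 := volume_preserving_piFinSuccAbove (fun _ : Fin (m + 1) => ℝ) 0
  have h3 := (MeasurePreserving.id (volume : Measure ℝ)).prod
    (PiLp.volume_preserving_toLp (Fin m))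
  have h4 := (h3.comp h2).comp h1
  exact h4

/-- Cavalieri's principle for the slices `x 0 = y`. -/
theorem volume_preimage_head_tail {m : ℕ} {B : Set (ℝ × EuclideanSpace ℝ (Fin m))}
    (hB : MeasurableSet B) :
    volume {x : EuclideanSpace ℝ (Fin (m + 1)) | (x 0, tail x) ∈ B} =
      ∫⁻ y : ℝ, volume {z | (y, z) ∈ B} := by
  have := (measurePreserving_head_tail m).measure_preimage hB.nullMeasurableSet
  rw [Measure.volume_eq_prod, Measure.prod_apply hB] at this
  exact this

/-- The volume of the unit ball of `ℝᵐ`. -/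
noncomputable def kappa (m : ℕ) : ℝ := volume.real (unitBall m)

theorem kappa_pos (m : ℕ) : 0 < kappa m :=
  ENNReal.toReal_pos (Metric.measure_closedBall_pos _ _ one_pos).ne' measure_closedBall_lt_top.ne

theorem volume_closedBall_eq {m : ℕ} {r : ℝ} (hr : 0 ≤ r) :
    volume (Metric.closedBall (0 : EuclideanSpace ℝ (Fin m)) r) =
      ENNReal.ofReal (kappa m * r ^ m) := by
  rw [mul_comm, ENNReal.ofReal_mul (by positivity), kappa, ofReal_measureReal
    (by exact measure_closedBall_lt_top.ne),
    unitBall, Measure.addHaar_closedBall' _ _ hr, finrank_euclideanSpace_fin]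

theorem volume_unitBall (m : ℕ) : volume (unitBall m) = ENNReal.ofReal (kappa m) := by
  rw [unitBall, volume_closedBall_eq zero_le_one, one_pow, mul_one]

theorem volume_ball_eq {m : ℕ} (hm : 1 ≤ m) {r : ℝ} (hr : 0 ≤ r) :
    volume (Metric.ball (0 : EuclideanSpace ℝ (Fin m)) r) = ENNReal.ofReal (kappa m * r ^ m) := by
  have : Nonempty (Fin m) := ⟨⟨0, hm⟩⟩
  rw [← volume_closedBall_eq hr, Measure.addHaar_closedBall_eq_addHaar_ball]

theorem kappa_succ_le (m : ℕ) : kappa (m + 1) ≤ 2 * kappa m := by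
  have hB : MeasurableSet
      (Set.Icc (-1 : ℝ) 1 ×ˢ Metric.closedBall (0 : EuclideanSpace ℝ (Fin m)) 1) :=
    measurableSet_Icc.prod measurableSet_closedBall
  have hsub : unitBall (m + 1) ⊆ {x | (x 0, tail x) ∈
      Set.Icc (-1 : ℝ) 1 ×ˢ Metric.closedBall (0 : EuclideanSpace ℝ (Fin m)) 1} := by
    intro x hx
    rw [unitBall, mem_closedBall_zero_iff] at hx
    have h := norm_sq_eq_head_add_tail x
    have h1 : ‖x‖ ^ 2 ≤ 1 := by nlinarith [norm_nonneg x]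
    have h2 : |x 0| ≤ 1 := by rw [← sq_le_one_iff_abs_le_one]; nlinarith [sq_nonneg ‖tail x‖]
    have h3 : ‖tail x‖ ≤ 1 := by
      rw [← sq_le_one_iff₀ (norm_nonneg _)]; nlinarith [sq_nonneg (x 0)]
    exact ⟨abs_le.1 h2, by simpa using h3⟩
  have h := measure_mono (μ := volume) hsub
  have h5 := (measurePreserving_head_tail m).measure_preimage hB.nullMeasurableSet
  rw [Measure.volume_eq_prod, Measure.prod_prod, Real.volume_Icc, volume_closedBall_eq zero_le_one]
    at h5
  rw [show {x : EuclideanSpace ℝ (Fin (m + 1)) | (x 0, tail x) ∈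
      Set.Icc (-1 : ℝ) 1 ×ˢ Metric.closedBall (0 : EuclideanSpace ℝ (Fin m)) 1} =
      (fun x => (x 0, tail x)) ⁻¹' _ from rfl, h5, volume_unitBall,
    ← ENNReal.ofReal_mul (by norm_num)] at h
  rw [ENNReal.ofReal_le_ofReal_iff (by have := kappa_pos m; positivity)] at h
  norm_num at h
  linarith

/-- Any unit vector can be rotated to any other, so the volume of a set defined through the inner
product with a unit vector and the norm does not depend on the vector. -/
theorem volume_inner_norm_eq {n : ℕ} {u v : EuclideanSpace ℝ (Fin n)} (huv : ‖u‖ = ‖v‖)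
    (Q : ℝ → ℝ → Prop) (hQ : MeasurableSet {x : EuclideanSpace ℝ (Fin n) | Q (inner ℝ u x) ‖x‖}) :
    volume {x | Q (inner ℝ v x) ‖x‖} = volume {x | Q (inner ℝ u x) ‖x‖} := by
  set f := (ℝ ∙ (u - v))ᗮ.reflection
  have hf : f v = u := by
    have h : f u = v := Submodule.reflection_sub huv
    rw [← h]; exact Submodule.reflection_reflection _ _
  rw [← f.measurePreserving.measure_preimage hQ.nullMeasurableSet]
  congr 1
  ext x
  simp only [Set.mem_ofPred_eq, Set.mem_preimage, LinearIsometryEquiv.norm_map]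
  rw [← hf, LinearIsometryEquiv.inner_map_map]

theorem inner_single_zero {m : ℕ} (x : EuclideanSpace ℝ (Fin (m + 1))) :
    inner ℝ (EuclideanSpace.single (0 : Fin (m + 1)) (1 : ℝ)) x = x 0 := by
  simp [EuclideanSpace.inner_single_left]

theorem measurableSet_cap {n : ℕ} (u : EuclideanSpace ℝ (Fin n)) (t : ℝ) :
    MeasurableSet {x : EuclideanSpace ℝ (Fin n) | ‖x‖ ≤ 1 ∧ t < inner ℝ u x} :=
  (measurableSet_le measurable_norm measurable_const).inter
    (measurableSet_lt (g := fun x : EuclideanSpace ℝ (Fin n) => inner ℝ u x) measurable_const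
      (measurable_const.inner measurable_id))

theorem measurableSet_cone {n : ℕ} (u : EuclideanSpace ℝ (Fin n)) (s : ℝ) :
    MeasurableSet {x : EuclideanSpace ℝ (Fin n) | ‖x‖ ≤ 1 ∧ s * ‖x‖ < inner ℝ u x} :=
  (measurableSet_le measurable_norm measurable_const).inter
    (measurableSet_lt (measurable_norm.const_mul s) (measurable_const.inner measurable_id))

/-- The profile `y ↦ (1 - y²)^(m/2)` of the slices of the ball, weighted by `y`, has the elementary
primitive `-(1 - y²)^(m/2+1) / (m+2)`. -/
theorem integral_mul_sqrt_pow {m : ℕ} {t : ℝ} (ht0 : 0 ≤ t) (ht1 : t ≤ 1) :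
    ∫ y in t..1, y * √(1 - y ^ 2) ^ m = √(1 - t ^ 2) ^ (m + 2) / (m + 2) := by
  have key : ∀ y ∈ Set.uIcc t 1, HasDerivAt
      (fun y : ℝ => -((1 - y ^ 2) ^ ((m : ℝ) / 2 + 1) / (m + 2))) (y * √(1 - y ^ 2) ^ m) y := by
    intro y hy
    rw [Set.uIcc_of_le ht1] at hy
    have hy1 : 0 ≤ 1 - y ^ 2 := by nlinarith [hy.1, hy.2]
    have h := ((((hasDerivAt_id y).pow 2).const_sub 1).rpow_const (p := (m : ℝ) / 2 + 1)
      (Or.inr (by have : (0 : ℝ) ≤ m := by positivity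
                  linarith)))
    have h' := (h.div_const ((m : ℝ) + 2)).neg
    refine h'.congr_deriv ?_
    have h2 : √(1 - y ^ 2) ^ m = (1 - y ^ 2) ^ ((m : ℝ) / 2) := by
      rw [Real.sqrt_eq_rpow, ← Real.rpow_natCast, ← Real.rpow_mul hy1]; ring_nf
    have h3 : (m : ℝ) + 2 ≠ 0 := by positivity
    rw [h2]
    simp only [id, Pi.pow_apply]
    rw [show (m : ℝ) / 2 + 1 - 1 = m / 2 by ring]
    field_simp
    ring
  have hp : ∀ t : ℝ, 0 ≤ 1 - t ^ 2 → √(1 - t ^ 2) ^ (m + 2) = (1 - t ^ 2) ^ ((m : ℝ) / 2 + 1) := by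
    intro t h
    rw [Real.sqrt_eq_rpow, ← Real.rpow_natCast, ← Real.rpow_mul h]; push_cast; ring_nf
  rw [intervalIntegral.integral_eq_sub_of_hasDerivAt key
    (Continuous.intervalIntegrable (by fun_prop) _ _), hp t (by nlinarith)]
  have : (0 : ℝ) ^ ((m : ℝ) / 2 + 1) = 0 := Real.zero_rpow (by positivity)
  simp [this]

/-- Upper bound for the volume of a cap of the unit ball. -/
theorem volume_cap_le {m : ℕ} {t : ℝ} (ht0 : 0 < t) (ht1 : t < 1)
    {u : EuclideanSpace ℝ (Fin (m + 1))} (hu : ‖u‖ = 1) :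
    volume {x : EuclideanSpace ℝ (Fin (m + 1)) | ‖x‖ ≤ 1 ∧ t < inner ℝ u x} ≤
      ENNReal.ofReal (kappa m * √(1 - t ^ 2) ^ (m + 2) / (t * (m + 2))) := by
  have hrot := volume_inner_norm_eq
    (u := EuclideanSpace.single (0 : Fin (m + 1)) (1 : ℝ)) (v := u) (by simp [hu])
    (fun a b => b ≤ 1 ∧ t < a) (measurableSet_cap _ t)
  rw [hrot]
  simp only [inner_single_zero]
  set B : Set (ℝ × EuclideanSpace ℝ (Fin m)) := {p | p.1 ∈ Set.Ioc t 1 ∧ ‖p.2‖ ≤ √(1 - p.1 ^ 2)}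
  have hB : MeasurableSet B :=
    (measurable_fst measurableSet_Ioc).inter (measurableSet_le measurable_snd.norm
      (((measurable_fst.pow_const 2).const_sub 1).sqrt))
  have hsub : {x : EuclideanSpace ℝ (Fin (m + 1)) | ‖x‖ ≤ 1 ∧ t < x 0} ⊆
      {x | (x 0, tail x) ∈ B} := by
    rintro x ⟨hx1, hx2⟩
    have h := norm_sq_eq_head_add_tail x
    have h1 : ‖x‖ ^ 2 ≤ 1 := by nlinarith [norm_nonneg x]
    exact ⟨⟨hx2, by nlinarith [sq_nonneg ‖tail x‖]⟩, Real.le_sqrt_of_sq_le (by simp only; linarith)⟩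
  refine (measure_mono hsub).trans ?_
  rw [volume_preimage_head_tail hB]
  have hk := (kappa_pos m).le
  calc ∫⁻ y : ℝ, volume {z | (y, z) ∈ B}
      ≤ ∫⁻ y in Set.Ioc t 1, ENNReal.ofReal (kappa m / t * (y * √(1 - y ^ 2) ^ m)) := by
        rw [← lintegral_indicator measurableSet_Ioc]
        refine lintegral_mono fun y => ?_
        by_cases hy : y ∈ Set.Ioc t 1
        · rw [Set.indicator_of_mem hy]
          have : {z | (y, z) ∈ B} ⊆ Metric.closedBall 0 (√(1 - y ^ 2)) := by
            rintro z ⟨-, hz⟩; simpa using hz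
          refine (measure_mono this).trans ?_
          rw [volume_closedBall_eq (Real.sqrt_nonneg _)]
          refine ENNReal.ofReal_le_ofReal ?_
          have h0 : 0 ≤ kappa m * √(1 - y ^ 2) ^ m := by positivity
          rw [show kappa m / t * (y * √(1 - y ^ 2) ^ m) =
            (kappa m * √(1 - y ^ 2) ^ m) * (y / t) by ring]
          exact le_mul_of_one_le_right h0 ((one_le_div ht0).2 hy.1.le)
        · rw [Set.indicator_of_notMem hy]
          have : {z | (y, z) ∈ B} = ∅ := by
            ext z; simp only [Set.mem_ofPred_eq, Set.mem_empty_iff_false, iff_false]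
            exact fun h => hy h.1
          simp [this]
    _ = ENNReal.ofReal (∫ y in Set.Ioc t 1, kappa m / t * (y * √(1 - y ^ 2) ^ m)) := by
        rw [ofReal_integral_eq_lintegral_ofReal]
        · exact (Continuous.integrableOn_Ioc (by fun_prop))
        · filter_upwards [ae_restrict_mem measurableSet_Ioc] with y hy
          have : 0 < y := ht0.trans hy.1
          positivity
    _ = _ := by
        rw [← intervalIntegral.integral_of_le ht1.le, intervalIntegral.integral_const_mul,
          integral_mul_sqrt_pow ht0.le ht1.le]
        congr 1
        field_simp

/-- Lower bound for the volume of a circular cone intersected with the unit ball: it contains the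
straight cone of height `s` over a base of radius `√(1 - s²)`. -/
theorem le_volume_cone {m : ℕ} (hm : 1 ≤ m) {s : ℝ} (hs0 : 0 < s) (hs1 : s < 1)
    {u : EuclideanSpace ℝ (Fin (m + 1))} (hu : ‖u‖ = 1) :
    ENNReal.ofReal (kappa m * s * √(1 - s ^ 2) ^ m / (m + 1)) ≤
      volume {x : EuclideanSpace ℝ (Fin (m + 1)) | ‖x‖ ≤ 1 ∧ s * ‖x‖ < inner ℝ u x} := by
  have hrot := volume_inner_norm_eq
    (u := EuclideanSpace.single (0 : Fin (m + 1)) (1 : ℝ)) (v := u) (by simp [hu])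
    (fun a b => b ≤ 1 ∧ s * b < a) (measurableSet_cone _ s)
  rw [hrot]
  simp only [inner_single_zero]
  set w := √(1 - s ^ 2) with hw
  have hw2 : w ^ 2 = 1 - s ^ 2 := Real.sq_sqrt (by nlinarith)
  have hw0 : 0 ≤ w := Real.sqrt_nonneg _
  set B : Set (ℝ × EuclideanSpace ℝ (Fin m)) := {p | p.1 ∈ Set.Ioc 0 s ∧ ‖p.2‖ < w / s * p.1}
  have hB : MeasurableSet B :=
    (measurable_fst measurableSet_Ioc).inter (measurableSet_lt measurable_snd.norm
      (measurable_fst.const_mul _))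
  have hsub : {x | (x 0, tail x) ∈ B} ⊆
      {x : EuclideanSpace ℝ (Fin (m + 1)) | ‖x‖ ≤ 1 ∧ s * ‖x‖ < x 0} := by
    rintro x ⟨⟨hx0, hxs⟩, hx2⟩
    simp only at hx0 hxs hx2
    have h := norm_sq_eq_head_add_tail x
    have h1 : s * ‖tail x‖ < w * x 0 := by
      rw [div_mul_eq_mul_div, lt_div_iff₀ hs0] at hx2; linarith
    have h2 : (s * ‖tail x‖) ^ 2 < (w * x 0) ^ 2 := by
      exact pow_lt_pow_left₀ h1 (by positivity) two_ne_zero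
    have h3 : (s * ‖x‖) ^ 2 < x 0 ^ 2 := by
      rw [mul_pow, h]; rw [mul_pow, mul_pow, hw2] at h2; nlinarith
    have h4 : s * ‖x‖ < x 0 := lt_of_pow_lt_pow_left₀ 2 hx0.le h3
    refine ⟨?_, h4⟩
    have h5 : s * ‖x‖ < s * 1 := by linarith
    exact (lt_of_mul_lt_mul_left h5 hs0.le).le
  refine le_trans ?_ (measure_mono hsub)
  rw [volume_preimage_head_tail hB]
  have hk := (kappa_pos m).le
  calc ENNReal.ofReal (kappa m * s * w ^ m / (m + 1))
      = ENNReal.ofReal (∫ y in Set.Ioc 0 s, kappa m * (w / s * y) ^ m) := by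
        rw [← intervalIntegral.integral_of_le hs0.le, intervalIntegral.integral_const_mul]
        simp_rw [mul_pow]
        rw [intervalIntegral.integral_const_mul, integral_pow]
        congr 1
        simp only [div_pow, pow_succ]
        field_simp
        ring
    _ = ∫⁻ y in Set.Ioc 0 s, ENNReal.ofReal (kappa m * (w / s * y) ^ m) := by
        rw [ofReal_integral_eq_lintegral_ofReal]
        · exact (Continuous.integrableOn_Ioc (by fun_prop))
        · filter_upwards [ae_restrict_mem measurableSet_Ioc] with y hy
          have : 0 < y := hy.1
          positivity
    _ ≤ _ := by
        rw [← lintegral_indicator measurableSet_Ioc]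
        refine lintegral_mono fun y => ?_
        by_cases hy : y ∈ Set.Ioc 0 s
        · rw [Set.indicator_of_mem hy]
          have hy0 : 0 < y := hy.1
          rw [← volume_ball_eq hm (by positivity)]
          refine measure_mono fun z hz => ⟨hy, by simpa using hz⟩
        · rw [Set.indicator_of_notMem hy]; exact zero_le

/-! ### A circumscribed polytope from a net of the sphere -/

/-- The unit sphere of `ℝⁿ` has a `1/2`-net of at most `5ⁿ` points, here scaled to the sphere of
radius `2`. -/
theorem exists_net (n : ℕ) : ∃ T : Finset (EuclideanSpace ℝ (Fin n)), T.card ≤ 5 ^ n ∧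
    (∀ c ∈ T, ‖c‖ = 2) ∧ ∀ u : EuclideanSpace ℝ (Fin n), ‖u‖ = 2 → ∃ c ∈ T, ‖u - c‖ < 1 := by
  classical
  let Sep (T : Finset (EuclideanSpace ℝ (Fin n))) : Prop :=
    (∀ c ∈ T, ‖c‖ = 2) ∧ ∀ c ∈ T, ∀ d ∈ T, c ≠ d → 1 ≤ ‖c - d‖
  have hcard : ∀ T, Sep T → T.card ≤ 5 ^ n := fun T hT => by
    simpa using Besicovitch.card_le_of_separated T (fun c hc => (hT.1 c hc).le) hT.2
  -- A separated set of maximal cardinality is a net.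
  have hfin : {k | ∃ T, Sep T ∧ T.card = k}.Finite :=
    (Set.finite_Iic (5 ^ n)).subset (by rintro _ ⟨T, hT, rfl⟩; exact hcard T hT)
  obtain ⟨k, ⟨T, hT, rfl⟩, hmax⟩ :=
    hfin.exists_maximal ⟨0, ∅, by simp [Sep], rfl⟩
  refine ⟨T, hcard T hT, hT.1, fun u hu => ?_⟩
  by_contra! hcon
  have huT : u ∉ T := fun h => by
    have := hcon u h
    simp at this
    linarith
  have hins : Sep (insert u T) := by
    refine ⟨fun c hc => ?_, fun c hc d hd hcd => ?_⟩
    · rcases Finset.mem_insert.1 hc with rfl | hc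
      exacts [hu, hT.1 c hc]
    · rcases Finset.mem_insert.1 hc with rfl | hc <;> rcases Finset.mem_insert.1 hd with hd | hd
      · exact absurd hd.symm hcd
      · exact hcon d hd
      · rw [hd, norm_sub_rev]; exact hcon c hc
      · exact hT.2 c hc d hd hcd
  have := hmax ⟨_, hins, rfl⟩ (Finset.card_le_card (Finset.subset_insert u T))
  rw [Finset.card_insert_of_notMem huT] at this
  omega

/-- The polytope circumscribed about the unit ball along the net lies in the ball of radius `8 / 7`:
unit vectors at distance at most `1/2` have inner product at least `7/8`. -/
theorem norm_le_of_net {n : ℕ} {T : Finset (EuclideanSpace ℝ (Fin n))}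
    (hT : ∀ c ∈ T, ‖c‖ = 2)
    (hnet : ∀ u : EuclideanSpace ℝ (Fin n), ‖u‖ = 2 → ∃ c ∈ T, ‖u - c‖ < 1)
    {x : EuclideanSpace ℝ (Fin n)} (hx : ∀ c ∈ T, inner ℝ c x ≤ 2) : ‖x‖ ≤ 8 / 7 := by
  rcases eq_or_ne x 0 with rfl | hx0
  · simp; norm_num
  have hpos : 0 < ‖x‖ := norm_pos_iff.2 hx0
  set u : EuclideanSpace ℝ (Fin n) := (2 / ‖x‖) • x with hu
  have hun : ‖u‖ = 2 := by
    rw [hu, norm_smul, Real.norm_of_nonneg (by positivity)]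
    field_simp
  obtain ⟨c, hc, hcu⟩ := hnet u hun
  have h1 : ‖u - c‖ ^ 2 < 1 := by nlinarith [norm_nonneg (u - c)]
  rw [norm_sub_sq_real, hun, hT c hc] at h1
  have h2 : inner ℝ u c = 2 / ‖x‖ * inner ℝ c x := by
    rw [hu, real_inner_smul_left, real_inner_comm]
  have h3 : inner ℝ u c ≤ 2 / ‖x‖ * 2 := by
    rw [h2]; exact mul_le_mul_of_nonneg_left (hx c hc) (by positivity)
  have h4 : 7 / 2 < 4 / ‖x‖ := by
    have : 2 / ‖x‖ * 2 = 4 / ‖x‖ := by ring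
    linarith
  rw [lt_div_iff₀ hpos] at h4
  linarith

/-! ### The radial integral -/

/-- Integral over a spherical shell of `‖x‖⁻ᵐ (1 + a (‖x‖ - 1))⁻⁽ᵐ⁺¹⁾` in `ℝ^(m+1)`: in polar
coordinates the Jacobian cancels the first factor. -/
theorem lintegral_shell_le {m : ℕ} (hm : 1 ≤ m) {a R : ℝ} (ha : 0 < a) (hR : 1 ≤ R) :
    ∫⁻ x in {x : EuclideanSpace ℝ (Fin (m + 1)) | ‖x‖ ∈ Set.Ioc 1 R},
      ENNReal.ofReal ((‖x‖ ^ m)⁻¹ * ((1 + a * (‖x‖ - 1)) ^ (m + 1))⁻¹) ≤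
      ENNReal.ofReal (2 * kappa (m + 1) / a) := by
  set h : ℝ → ℝ := fun r => (r ^ m)⁻¹ * ((1 + a * (r - 1)) ^ (m + 1))⁻¹ with hh
  set S : Set (EuclideanSpace ℝ (Fin (m + 1))) := {x | ‖x‖ ∈ Set.Ioc 1 R} with hS
  have hSm : MeasurableSet S := measurable_norm measurableSet_Ioc
  have hSfin : volume S < ⊤ := by
    refine (measure_mono (t := Metric.closedBall 0 R) fun x hx => ?_).trans_lt
      measure_closedBall_lt_top
    simpa using hx.2
  have hbd : ∀ r ∈ Set.Ioc 1 R, 0 ≤ h r ∧ h r ≤ 1 := by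
    intro r hr
    have h1 : 1 ≤ r := hr.1.le
    have h2 : 1 ≤ 1 + a * (r - 1) := by nlinarith
    refine ⟨by positivity, mul_le_one₀ ?_ (by positivity) ?_⟩
    · exact inv_le_one_of_one_le₀ (one_le_pow₀ h1)
    · exact inv_le_one_of_one_le₀ (one_le_pow₀ h2)
  have hmeas : Measurable h := by fun_prop
  have hint : IntegrableOn (fun x : EuclideanSpace ℝ (Fin (m + 1)) => h ‖x‖) S := by
    refine Measure.integrableOn_of_bounded (M := 1) hSfin.ne
      (hmeas.comp measurable_norm).aestronglyMeasurable ?_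
    filter_upwards [ae_restrict_mem hSm] with x hx
    rw [Real.norm_of_nonneg (hbd _ hx).1]
    exact (hbd _ hx).2
  have hpolar : ∫ x in S, h ‖x‖ =
      ((m + 1 : ℕ) : ℝ) * kappa (m + 1) * ∫ r in 1..R, ((1 + a * (r - 1)) ^ (m + 1))⁻¹ := by
    have key := integral_fun_norm_addHaar (volume : Measure (EuclideanSpace ℝ (Fin (m + 1))))
      ((Set.Ioc 1 R).indicator h)
    have e1 : ∀ x : EuclideanSpace ℝ (Fin (m + 1)),
        (Set.Ioc 1 R).indicator h ‖x‖ = S.indicator (fun x => h ‖x‖) x := fun x => rfl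
    simp_rw [e1] at key
    rw [integral_indicator hSm] at key
    rw [key, finrank_euclideanSpace_fin]
    have e2 : ∀ y : ℝ, y ^ (m + 1 - 1) • (Set.Ioc 1 R).indicator h y =
        (Set.Ioc 1 R).indicator (fun y => y ^ m * h y) y := fun y => by
      rw [Nat.add_sub_cancel, smul_eq_mul]
      by_cases hy : y ∈ Set.Ioc 1 R <;> simp [hy]
    simp_rw [e2]
    rw [setIntegral_indicator measurableSet_Ioc,
      Set.inter_eq_self_of_subset_right (s := Set.Ioi (0 : ℝ)) (t := Set.Ioc 1 R)
        (fun y hy => zero_lt_one.trans hy.1),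
      intervalIntegral.integral_of_le hR]
    have e3 : volume.real (Metric.ball (0 : EuclideanSpace ℝ (Fin (m + 1))) 1) = kappa (m + 1) := by
      rw [measureReal_def, volume_ball_eq (by omega) zero_le_one, one_pow, mul_one,
        ENNReal.toReal_ofReal (kappa_pos _).le]
    rw [e3, nsmul_eq_mul, smul_eq_mul, mul_assoc]
    congr 2
    refine setIntegral_congr_fun measurableSet_Ioc fun y hy => ?_
    have : y ≠ 0 := (zero_lt_one.trans hy.1).ne'
    simp only [hh]
    field_simp
  rw [← ofReal_integral_eq_lintegral_ofReal hint
    (by filter_upwards [ae_restrict_mem hSm] with x hx using (hbd _ hx).1), hpolar]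
  refine ENNReal.ofReal_le_ofReal ?_
  have hm' : (0 : ℝ) < m := by exact_mod_cast hm
  have hI : ∫ r in 1..R, ((1 + a * (r - 1)) ^ (m + 1))⁻¹ ≤ 1 / (a * m) := by
    have hd : ∀ y ∈ Set.uIcc 1 R, HasDerivAt (fun y => -(((1 + a * (y - 1)) ^ m)⁻¹ / (a * m)))
        (((1 + a * (y - 1)) ^ (m + 1))⁻¹) y := by
      intro y hy
      rw [Set.uIcc_of_le hR] at hy
      have hpos : 0 < 1 + a * (y - 1) := by nlinarith [hy.1]
      have h1 : HasDerivAt (fun y : ℝ => 1 + a * (y - 1)) (a * 1) y :=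
        (((hasDerivAt_id y).sub_const 1).const_mul a).const_add 1
      have h2 := (((h1.pow m).inv (pow_pos hpos m).ne').div_const (a * m)).neg
      refine h2.congr_deriv ?_
      obtain ⟨k, rfl⟩ : ∃ k, m = k + 1 := ⟨m - 1, by omega⟩
      simp only [Nat.add_sub_cancel, Pi.pow_apply]
      field_simp
      ring
    rw [intervalIntegral.integral_eq_sub_of_hasDerivAt hd]
    · have : 0 ≤ ((1 + a * (R - 1)) ^ m)⁻¹ / (a * m) := by
        have : 0 ≤ 1 + a * (R - 1) := by nlinarith
        positivity
      simp only [sub_self, mul_zero, add_zero, one_pow, inv_one]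
      linarith
    · refine ContinuousOn.intervalIntegrable ?_
      refine ContinuousOn.inv₀ (by fun_prop) fun y hy => ?_
      rw [Set.uIcc_of_le hR] at hy
      have hpos : 0 < 1 + a * (y - 1) := by nlinarith [hy.1]
      positivity
  have hk := kappa_pos (m + 1)
  calc _ ≤ ((m + 1 : ℕ) : ℝ) * kappa (m + 1) * (1 / (a * m)) := by gcongr
    _ ≤ 2 * kappa (m + 1) / a := by
      rw [mul_one_div, div_le_div_iff₀ (by positivity) ha]
      have : (1 : ℝ) ≤ m := by exact_mod_cast hm
      push_cast
      have : 0 ≤ kappa (m + 1) * a * (m - 1) := by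
        have : 0 ≤ (m : ℝ) - 1 := by linarith
        positivity
      linarith

/-- Used with `e⁻ᶻ` a bound for the probability that a point at distance `r` survives all random cuts:
the sixth-order bound `e⁻ᶻ ≤ 6! z⁻⁶` beats the Jacobian `rᵐ` and leaves an integrable power of
`1 + a (r - 1)`. -/
theorem exp_neg_le_of_pow_le {m : ℕ} (hm : 1 ≤ m) {r a z : ℝ} (hr : 1 ≤ r) (ha : 1 ≤ a)
    (hz : 0 < z) (h : (1 + a * (r - 1)) ^ m ≤ 4 * z ^ 2) :
    Real.exp (-z) ≤ 46080 * ((r ^ m)⁻¹ * ((1 + a * (r - 1)) ^ (m + 1))⁻¹) := by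
  set b := 1 + a * (r - 1) with hb
  have hrb : r ≤ b := by nlinarith
  have hb1 : 1 ≤ b := hr.trans hrb
  have h1 : z ^ 6 / 720 ≤ Real.exp z := by
    have := Real.pow_div_factorial_le_exp z hz.le 6
    norm_num [Nat.factorial] at this
    exact this
  have h2 : r ^ m * b ^ (m + 1) ≤ (b ^ m) ^ 3 := by
    calc r ^ m * b ^ (m + 1) ≤ b ^ m * b ^ (2 * m) := by
          gcongr
          omega
      _ = (b ^ m) ^ 3 := by ring
  have h3 : (b ^ m) ^ 3 ≤ (4 * z ^ 2) ^ 3 := by gcongr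
  have hpos : 0 < r ^ m * b ^ (m + 1) := by positivity
  rw [Real.exp_neg, ← mul_inv, ← div_eq_mul_inv, inv_le_comm₀ (Real.exp_pos z) (by positivity),
    inv_div]
  refine le_trans ?_ h1
  rw [div_le_div_iff₀ (by norm_num) (by norm_num)]
  nlinarith

/-! ### The first-moment method -/

/-- First-moment method: for `M` independent random points of law `ν`, some outcome leaves at most
the expected volume of `S` uncut. -/
theorem exists_volume_inter_le {E : Type*} [MeasurableSpace E] (μ ν : Measure E) [SFinite μ]
    [IsProbabilityMeasure ν] (M : ℕ) {S : Set E} {G : Set (E × E)}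
    (hG : MeasurableSet G) :
    ∃ ω : Fin M → E, μ (S ∩ {x | ∀ i, (x, ω i) ∈ G}) ≤ ∫⁻ x in S, ν {ξ | (x, ξ) ∈ G} ^ M ∂μ := by
  set W : Set ((Fin M → E) × E) := {p | ∀ i, (p.2, p.1 i) ∈ G} with hWdef
  have hW : MeasurableSet W := by
    have : W = ⋂ i, {p : (Fin M → E) × E | (p.2, p.1 i) ∈ G} := by ext; simp [W]
    rw [this]
    exact MeasurableSet.iInter fun i =>
      (measurable_snd.prodMk ((measurable_pi_apply i).comp measurable_fst)) hG
  obtain ⟨ω, hω⟩ := exists_le_lintegral (μ := Measure.pi fun _ : Fin M => ν)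
    (f := fun ω => μ.restrict S (Prod.mk ω ⁻¹' W)) (measurable_measure_prodMk_left hW).aemeasurable
  refine ⟨ω, ?_⟩
  have h1 : μ (S ∩ {x | ∀ i, (x, ω i) ∈ G}) = μ.restrict S (Prod.mk ω ⁻¹' W) := by
    rw [Measure.restrict_apply (measurable_prodMk_left hW), Set.inter_comm]
    rfl
  rw [h1]
  refine hω.trans (le_of_eq ?_)
  rw [← Measure.prod_apply hW, Measure.prod_apply_symm hW]
  refine lintegral_congr fun x => ?_
  have h2 : (fun ω : Fin M → E => (ω, x)) ⁻¹' W = Set.univ.pi fun _ => {ξ | (x, ξ) ∈ G} := by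
    ext ω; simp [W]
  rw [h2, Measure.pi_pi]
  simp

/-! ### The random polytope -/

/-- The probability that a point `x` outside the ball survives `M` random cuts. Here `w₀` is the
radius of the base of the cap cut off by one hyperplane. The calibration `hcal` says that `M` straight
cones of unit height over such bases have the total volume of the ball, so that a point of the sphere
is cut about once on average. -/
theorem survival_le {m M : ℕ} (hm : 1 ≤ m) (hM : 1 ≤ M) {t w₀ : ℝ} (hw : 0 < w₀) (hw2 : w₀ ≤ 1 / 2)
    (ht : 0 < t) (htw : t ^ 2 = 1 - w₀ ^ 2)
    (hcal : w₀ ^ m * (M * kappa m) = (m + 1) * kappa (m + 1))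
    {x : EuclideanSpace ℝ (Fin (m + 1))} (hx : ‖x‖ ∈ Set.Ioc 1 (8 / 7)) :
    (ProbabilityTheory.cond volume (unitBall (m + 1)) {ξ | inner ℝ ξ x ≤ t * ‖ξ‖}) ^ M ≤
      ENNReal.ofReal (46080 * ((‖x‖ ^ m)⁻¹ *
        ((1 + t ^ 2 / w₀ ^ 2 * (‖x‖ - 1)) ^ (m + 1))⁻¹)) := by
  set D := unitBall (m + 1) with hD
  set ν := ProbabilityTheory.cond volume D with hν
  have hDvol : volume D = ENNReal.ofReal (kappa (m + 1)) := volume_unitBall _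
  have hk := kappa_pos m
  have hk1 := kappa_pos (m + 1)
  have hDm : MeasurableSet D := measurableSet_closedBall
  have hDfin : volume D ≠ ⊤ := by rw [hDvol]; exact ENNReal.ofReal_ne_top
  have : IsProbabilityMeasure ν :=
    ProbabilityTheory.cond_isProbabilityMeasure_of_finite (by rw [hDvol]; simpa using hk1) hDfin
  set r := ‖x‖ with hr
  obtain ⟨hr1, hr2⟩ := hx
  have hr0 : 0 < r := by linarith
  set s := t / r with hs
  have ht1 : t < 1 := by nlinarith
  have hs1 : s < 1 := by rw [hs, div_lt_one hr0]; linarith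
  have hs0 : 0 < s := by positivity
  have htlow : 6 / 7 ≤ t := by nlinarith
  have hs2 : 1 / 2 ≤ s := by rw [hs, le_div_iff₀ hr0]; linarith
  set w := √(1 - s ^ 2) with hwd
  have hwsq : w ^ 2 = 1 - s ^ 2 := Real.sq_sqrt (by nlinarith)
  have hw0 : 0 < w := Real.sqrt_pos.2 (by nlinarith)
  set u := r⁻¹ • x with hu
  have hun : ‖u‖ = 1 := by
    rw [hu, norm_smul, norm_inv, norm_norm, ← hr, inv_mul_cancel₀ hr0.ne']
  set K : Set (EuclideanSpace ℝ (Fin (m + 1))) := {ξ | ‖ξ‖ ≤ 1 ∧ s * ‖ξ‖ < inner ℝ u ξ} with hK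
  have hKm : MeasurableSet K := measurableSet_cone u s
  -- Up to a constant, `z` is the expected number of hyperplanes separating `x` from the origin.
  set z := s * (w / w₀) ^ m with hz
  have hz0 : 0 < z := by positivity
  have hM0 : (0 : ℝ) < M := by exact_mod_cast hM
  have hKν : ENNReal.ofReal (z / M) ≤ ν K := by
    have hKD : D ∩ K = K := Set.inter_eq_self_of_subset_right fun ξ hξ => by
      rw [hD, unitBall, mem_closedBall_zero_iff]; exact hξ.1
    rw [hν, ProbabilityTheory.cond_apply hDm, hKD, hDvol, ← ENNReal.ofReal_inv_of_pos hk1]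
    refine le_trans (le_of_eq ?_) (mul_le_mul_right (le_volume_cone hm hs0 hs1 hun) _)
    rw [← ENNReal.ofReal_mul (by positivity), hz, div_pow]
    congr 1
    have hcal' : kappa (m + 1) = w₀ ^ m * (M * kappa m) / (m + 1) := by
      rw [hcal]; field_simp
    rw [hcal', ← hwd]
    field_simp
  have hsub : {ξ : EuclideanSpace ℝ (Fin (m + 1)) | inner ℝ ξ x ≤ t * ‖ξ‖} ⊆ Kᶜ := by
    intro ξ hξ hξK
    have h1 : inner ℝ u ξ = r⁻¹ * inner ℝ ξ x := by
      rw [hu, real_inner_smul_left, real_inner_comm]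
    have h2 := hξK.2
    rw [h1, hs, div_mul_eq_mul_div, inv_mul_eq_div, div_lt_div_iff_of_pos_right hr0] at h2
    exact absurd hξ (not_le.2 h2)
  have hprob : ν {ξ : EuclideanSpace ℝ (Fin (m + 1)) | inner ℝ ξ x ≤ t * ‖ξ‖} ≤
      ENNReal.ofReal (Real.exp (-(z / M))) := by
    refine (measure_mono hsub).trans ?_
    rw [prob_compl_eq_one_sub hKm]
    refine (tsub_le_tsub_left hKν 1).trans ?_
    rw [← ENNReal.ofReal_one, ← ENNReal.ofReal_sub _ (by positivity)]
    refine ENNReal.ofReal_le_ofReal ?_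
    have := Real.add_one_le_exp (-(z / M))
    linarith
  refine (pow_le_pow_left' hprob M).trans ?_
  rw [← ENNReal.ofReal_pow (Real.exp_pos _).le, ← Real.exp_nat_mul,
    show (M : ℝ) * -(z / M) = -z by field_simp]
  refine ENNReal.ofReal_le_ofReal (exp_neg_le_of_pow_le hm hr1.le ?_ hz0 ?_)
  · rw [one_le_div (by positivity)]; nlinarith
  · have hb : 1 + t ^ 2 / w₀ ^ 2 * (r - 1) ≤ (w / w₀) ^ 2 := by
      rw [div_pow, hwsq, hs, div_pow, le_div_iff₀ (by positivity)]
      have e : (1 + t ^ 2 / w₀ ^ 2 * (r - 1)) * w₀ ^ 2 = w₀ ^ 2 + t ^ 2 * (r - 1) := by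
        field_simp
      rw [e]
      have h1 : t ^ 2 / r ^ 2 + t ^ 2 * (r - 1) ≤ t ^ 2 := by
        rw [div_add' _ _ _ (by positivity), div_le_iff₀ (by positivity)]
        have h2 : 0 ≤ r + 1 - r ^ 2 := by nlinarith
        have : 1 + (r - 1) * r ^ 2 ≤ r ^ 2 := by
          nlinarith [mul_nonneg (sub_nonneg.2 hr1.le) h2]
        nlinarith [sq_nonneg t]
      linarith
    have hb0 : 0 ≤ 1 + t ^ 2 / w₀ ^ 2 * (r - 1) := by
      have : 0 ≤ r - 1 := by linarith
      positivity
    calc (1 + t ^ 2 / w₀ ^ 2 * (r - 1)) ^ m ≤ ((w / w₀) ^ 2) ^ m := by gcongr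
      _ = 1 * ((w / w₀) ^ m) ^ 2 := by ring
      _ ≤ (4 * s ^ 2) * ((w / w₀) ^ m) ^ 2 := by gcongr; nlinarith
      _ = 4 * z ^ 2 := by rw [hz]; ring

/-- There are `M` hyperplanes at distance `t` from the origin that leave little of the shell
`1 < ‖x‖ ≤ 8/7` uncut. -/
theorem exists_cuts {m M : ℕ} (hm : 1 ≤ m) (hM : 1 ≤ M) {t w₀ : ℝ} (hw : 0 < w₀) (hw2 : w₀ ≤ 1 / 2)
    (ht : 0 < t) (htw : t ^ 2 = 1 - w₀ ^ 2)
    (hcal : w₀ ^ m * (M * kappa m) = (m + 1) * kappa (m + 1)) :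
    ∃ ω : Fin M → EuclideanSpace ℝ (Fin (m + 1)),
      volume ({x | ‖x‖ ∈ Set.Ioc 1 (8 / 7)} ∩ {x | ∀ i, inner ℝ (ω i) x ≤ t * ‖ω i‖}) ≤
        ENNReal.ofReal (92160 * kappa (m + 1) * (w₀ ^ 2 / t ^ 2)) := by
  have hDvol := volume_unitBall (m + 1)
  have hprob : IsProbabilityMeasure
      (ProbabilityTheory.cond volume (unitBall (m + 1))) :=
    ProbabilityTheory.cond_isProbabilityMeasure_of_finite
      (by rw [hDvol]; simpa using kappa_pos (m + 1)) (by rw [hDvol]; exact ENNReal.ofReal_ne_top)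
  have hG : MeasurableSet {p : EuclideanSpace ℝ (Fin (m + 1)) × EuclideanSpace ℝ (Fin (m + 1)) |
      inner ℝ p.2 p.1 ≤ t * ‖p.2‖} :=
    (isClosed_le (by fun_prop) (by fun_prop)).measurableSet
  obtain ⟨ω, hω⟩ := exists_volume_inter_le volume
    (ProbabilityTheory.cond volume (unitBall (m + 1))) M
    (S := {x | ‖x‖ ∈ Set.Ioc 1 (8 / 7)}) hG
  refine ⟨ω, hω.trans ?_⟩
  have hS : MeasurableSet {x : EuclideanSpace ℝ (Fin (m + 1)) | ‖x‖ ∈ Set.Ioc 1 (8 / 7)} :=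
    measurable_norm measurableSet_Ioc
  refine (setLIntegral_mono_ae' hS (Filter.Eventually.of_forall fun x hx =>
    survival_le hm hM hw hw2 ht htw hcal hx)).trans ?_
  simp_rw [ENNReal.ofReal_mul (show (0 : ℝ) ≤ 46080 by norm_num)]
  rw [lintegral_const_mul' _ _ ENNReal.ofReal_ne_top]
  refine (mul_le_mul_right (lintegral_shell_le hm (by positivity) (by norm_num)) _).trans ?_
  rw [← ENNReal.ofReal_mul (by norm_num)]
  refine ENNReal.ofReal_le_ofReal (le_of_eq ?_)
  field_simp
  ring

/-- `M` hyperplanes at distance `t` from the origin cut little from the ball, whatever their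
directions: this is a union bound over the caps, made sharp by the calibration of `w₀`. -/
theorem volume_ball_diff_cuts_le {m M : ℕ} {t w₀ : ℝ} (hw : 0 < w₀)
    (ht : 0 < t) (htw : t ^ 2 = 1 - w₀ ^ 2)
    (hcal : w₀ ^ m * (M * kappa m) = (m + 1) * kappa (m + 1))
    (ω : Fin M → EuclideanSpace ℝ (Fin (m + 1))) :
    volume {x | ‖x‖ ≤ 1 ∧ ∃ i, t * ‖ω i‖ < inner ℝ (ω i) x} ≤
      ENNReal.ofReal (kappa (m + 1) * (w₀ ^ 2 / t)) := by
  have hk := kappa_pos m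
  have hk1 := kappa_pos (m + 1)
  have hsq : √(1 - t ^ 2) = w₀ := by rw [htw, sub_sub_cancel, Real.sqrt_sq hw.le]
  have hone : ∀ i, volume {x | ‖x‖ ≤ 1 ∧ t * ‖ω i‖ < inner ℝ (ω i) x} ≤
      ENNReal.ofReal (kappa m * w₀ ^ (m + 2) / (t * (m + 2))) := by
    intro i
    rcases eq_or_ne (ω i) 0 with h0 | h0
    · simp [h0]
    have hpos : 0 < ‖ω i‖ := norm_pos_iff.2 h0
    have hun : ‖‖ω i‖⁻¹ • ω i‖ = 1 := by
      rw [norm_smul, norm_inv, norm_norm, inv_mul_cancel₀ hpos.ne']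
    have hcap := volume_cap_le ht (by nlinarith : t < 1) hun
    rw [hsq] at hcap
    refine le_trans (measure_mono ?_) hcap
    rintro x ⟨hx1, hx2⟩
    refine ⟨hx1, ?_⟩
    rw [real_inner_smul_left, inv_mul_eq_div, lt_div_iff₀ hpos]
    exact hx2
  have hU : {x | ‖x‖ ≤ 1 ∧ ∃ i, t * ‖ω i‖ < inner ℝ (ω i) x} =
      ⋃ i, {x | ‖x‖ ≤ 1 ∧ t * ‖ω i‖ < inner ℝ (ω i) x} := by ext; simp
  rw [hU]
  calc _ ≤ ∑ i, volume {x | ‖x‖ ≤ 1 ∧ t * ‖ω i‖ < inner ℝ (ω i) x} :=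
        measure_iUnion_fintype_le _ _
    _ ≤ ∑ _i : Fin M, ENNReal.ofReal (kappa m * w₀ ^ (m + 2) / (t * (m + 2))) :=
        Finset.sum_le_sum fun i _ => hone i
    _ = ENNReal.ofReal (M * (kappa m * w₀ ^ (m + 2) / (t * (m + 2)))) := by
        rw [ENNReal.ofReal_mul (by positivity)]; simp
    _ ≤ _ := by
        refine ENNReal.ofReal_le_ofReal ?_
        have e : M * (kappa m * w₀ ^ (m + 2) / (t * (m + 2))) =
            (w₀ ^ m * (M * kappa m)) * w₀ ^ 2 / (t * (m + 2)) := by ring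
        rw [e, hcal, ← mul_div_assoc, div_le_div_iff₀ (by positivity) ht]
        have : 0 ≤ kappa (m + 1) * w₀ ^ 2 * t := by positivity
        nlinarith

/-- The random cuts are combined with the polytope circumscribed along the net, which confines the
intersection to the ball of radius `8 / 7`. -/
theorem exists_polytope {m M N : ℕ} (hm : 1 ≤ m) (hM : 1 ≤ M) (hMN : M + 5 ^ (m + 1) ≤ N)
    {w₀ : ℝ} (hw : 0 < w₀) (hw2 : w₀ ≤ 1 / 2)
    (hcal : w₀ ^ m * (M * kappa m) = (m + 1) * kappa (m + 1)) :
    ∃ P : Set (EuclideanSpace ℝ (Fin (m + 1))), IsPolytopeWithFacetsLE N P ∧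
      symmVolDiff (unitBall (m + 1)) P ≤ 150000 * w₀ ^ 2 * kappa (m + 1) := by
  classical
  have hk1 := kappa_pos (m + 1)
  set t := √(1 - w₀ ^ 2) with htd
  have htw : t ^ 2 = 1 - w₀ ^ 2 := Real.sq_sqrt (by nlinarith)
  have ht : 0 < t := Real.sqrt_pos.2 (by nlinarith)
  have htlow : 6 / 7 ≤ t := by nlinarith
  have ht1 : t < 1 := by nlinarith
  obtain ⟨ω, hω⟩ := exists_cuts hm hM hw hw2 ht htw hcal
  have hin := volume_ball_diff_cuts_le hw ht htw hcal ω
  obtain ⟨T, hTcard, hTnorm, hTnet⟩ := exists_net (m + 1)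
  -- A random normal may vanish; its inequality is then vacuous and is dropped.
  set s₁ : Finset (EuclideanSpace ℝ (Fin (m + 1)) × ℝ) :=
    (Finset.univ.image fun i => (ω i, t * ‖ω i‖)).filter fun p => p.1 ≠ 0
  set s₂ : Finset (EuclideanSpace ℝ (Fin (m + 1)) × ℝ) := T.image fun c => (c, 2)
  set P : Set (EuclideanSpace ℝ (Fin (m + 1))) := {x | ∀ p ∈ s₁ ∪ s₂, inner ℝ p.1 x ≤ p.2} with hP
  have hs : ∀ p ∈ s₁ ∪ s₂, p.1 ≠ 0 := by
    intro p hp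
    rcases Finset.mem_union.1 hp with hp | hp
    · exact (Finset.mem_filter.1 hp).2
    · obtain ⟨c, hc, rfl⟩ := Finset.mem_image.1 hp
      exact fun h => by simpa [show c = 0 from h] using hTnorm c hc
  have hcard : (s₁ ∪ s₂).card ≤ N := by
    refine (Finset.card_union_le _ _).trans (le_trans (add_le_add ?_ ?_) hMN)
    · exact (Finset.card_filter_le _ _).trans (Finset.card_image_le.trans (by simp))
    · exact Finset.card_image_le.trans hTcard
  have hPmem : ∀ x, x ∈ P ↔ (∀ i, inner ℝ (ω i) x ≤ t * ‖ω i‖) ∧ ∀ c ∈ T, inner ℝ c x ≤ 2 := by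
    intro x
    constructor
    · intro hx
      refine ⟨fun i => ?_, fun c hc => ?_⟩
      · rcases eq_or_ne (ω i) 0 with h0 | h0
        · simp [h0]
        · exact hx (ω i, t * ‖ω i‖) (Finset.mem_union_left _ (Finset.mem_filter.2
            ⟨Finset.mem_image_of_mem _ (Finset.mem_univ i), h0⟩))
      · exact hx (c, 2) (Finset.mem_union_right _ (Finset.mem_image_of_mem _ hc))
    · rintro ⟨h1, h2⟩ p hp
      rcases Finset.mem_union.1 hp with hp | hp
      · obtain ⟨i, -, rfl⟩ := Finset.mem_image.1 (Finset.mem_filter.1 hp).1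
        exact h1 i
      · obtain ⟨c, hc, rfl⟩ := Finset.mem_image.1 hp
        exact h2 c hc
  have hPnorm : ∀ x ∈ P, ‖x‖ ≤ 8 / 7 := fun x hx =>
    norm_le_of_net hTnorm hTnet ((hPmem x).1 hx).2
  have hnetBall : ∀ x : EuclideanSpace ℝ (Fin (m + 1)), ‖x‖ ≤ 1 → ∀ c ∈ T, inner ℝ c x ≤ 2 := by
    intro x hx c hc
    have := real_inner_le_norm c x
    rw [hTnorm c hc] at this
    linarith
  have hballP : Metric.ball 0 t ⊆ P := by
    intro x hx
    rw [mem_ball_zero_iff] at hx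
    refine (hPmem x).2 ⟨fun i => ?_, hnetBall x (by linarith)⟩
    refine (real_inner_le_norm _ _).trans ?_
    rw [mul_comm]
    exact mul_le_mul_of_nonneg_right hx.le (norm_nonneg _)
  have hint : (interior P).Nonempty :=
    ⟨0, interior_maximal hballP Metric.isOpen_ball (Metric.mem_ball_self ht)⟩
  refine ⟨P, ⟨⟨⟨s₁ ∪ s₂, hs, hP⟩, ?_, hint⟩, ?_⟩, ?_⟩
  · exact (Metric.isBounded_closedBall (x := 0) (r := 8 / 7)).subset
      fun x hx => mem_closedBall_zero_iff.2 (hPnorm x hx)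
  · exact (encard_facets_le hs hP hint).trans (by exact_mod_cast hcard)
  have hsub : unitBall (m + 1) ∆ P ⊆
      {x | ‖x‖ ≤ 1 ∧ ∃ i, t * ‖ω i‖ < inner ℝ (ω i) x} ∪
      ({x | ‖x‖ ∈ Set.Ioc 1 (8 / 7)} ∩ {x | ∀ i, inner ℝ (ω i) x ≤ t * ‖ω i‖}) := by
    rintro x (⟨hxD, hxP⟩ | ⟨hxP, hxD⟩)
    · rw [unitBall, mem_closedBall_zero_iff] at hxD
      refine Or.inl ⟨hxD, ?_⟩
      by_contra! hcon
      exact hxP ((hPmem x).2 ⟨hcon, hnetBall x hxD⟩)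
    · rw [unitBall, mem_closedBall_zero_iff, not_le] at hxD
      exact Or.inr ⟨⟨hxD, hPnorm x hxP⟩, ((hPmem x).1 hxP).1⟩
  have hle : volume (unitBall (m + 1) ∆ P) ≤ ENNReal.ofReal
      (kappa (m + 1) * (w₀ ^ 2 / t) + 92160 * kappa (m + 1) * (w₀ ^ 2 / t ^ 2)) := by
    rw [ENNReal.ofReal_add (by positivity) (by positivity)]
    exact (measure_mono hsub).trans ((measure_union_le _ _).trans (add_le_add hin hω))
  refine (ENNReal.toReal_le_of_le_ofReal (by positivity) hle).trans ?_
  have h1 : w₀ ^ 2 / t ≤ 3 / 2 * w₀ ^ 2 := by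
    rw [div_le_iff₀ ht]; nlinarith [sq_nonneg w₀]
  have h2 : w₀ ^ 2 / t ^ 2 ≤ 3 / 2 * w₀ ^ 2 := by
    have : 2 / 3 ≤ t ^ 2 := by nlinarith
    rw [div_le_iff₀ (by positivity)]; nlinarith [sq_nonneg w₀]
  calc _ ≤ kappa (m + 1) * (3 / 2 * w₀ ^ 2) + 92160 * kappa (m + 1) * (3 / 2 * w₀ ^ 2) := by gcongr
    _ ≤ 150000 * w₀ ^ 2 * kappa (m + 1) := by
      have : 0 ≤ w₀ ^ 2 * kappa (m + 1) := by positivity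
      linarith

/-- Calibration of `w₀`: it is of order `N ^ (-1/m)`, with a constant independent of `m`. -/
theorem exists_approximating_polytope {m N : ℕ} (hm : 1 ≤ m) (hN : 10 ^ (m + 1) ≤ N) :
    ∃ P : Set (EuclideanSpace ℝ (Fin (m + 1))), IsPolytopeWithFacetsLE N P ∧
      symmVolDiff (unitBall (m + 1)) P ≤
        10 ^ 7 * (N : ℝ) ^ (-(2 : ℝ) / m) * kappa (m + 1) := by
  have hk := kappa_pos m
  have hk1 := kappa_pos (m + 1)
  have hm0 : (0 : ℝ) < m := by exact_mod_cast hm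
  -- The net costs `5 ^ (m + 1) ≤ N / 2` facets; at least `N / 2` remain for the random cuts.
  have h510 : 2 * 5 ^ (m + 1) ≤ 10 ^ (m + 1) := by
    rw [show (10 : ℕ) = 2 * 5 from rfl, mul_pow]
    exact Nat.mul_le_mul_right _ (Nat.le_self_pow (by omega) 2)
  have h5pos : 0 < 5 ^ (m + 1) := by positivity
  obtain ⟨M, hM⟩ : ∃ M, M + 5 ^ (m + 1) = N := ⟨N - 5 ^ (m + 1), by omega⟩
  have hM1 : 1 ≤ M := by omega
  have hMhalf : (N : ℝ) ≤ 2 * M := by exact_mod_cast (by omega : N ≤ 2 * M)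
  have hM0 : (0 : ℝ) < M := by exact_mod_cast hM1
  have hN' : (10 : ℝ) ^ (m + 1) ≤ N := by exact_mod_cast hN
  have hN0 : (0 : ℝ) < N := lt_of_lt_of_le (by positivity) hN'
  set q : ℝ := (m + 1) * kappa (m + 1) / (M * kappa m) with hq
  have hq0 : 0 < q := by positivity
  set w₀ := q ^ ((m : ℝ)⁻¹) with hwd
  have hw : 0 < w₀ := Real.rpow_pos_of_pos hq0 _
  have hwm : w₀ ^ m = q := Real.rpow_inv_natCast_pow hq0.le (by omega)
  have hcal : w₀ ^ m * (M * kappa m) = (m + 1) * kappa (m + 1) := by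
    rw [hwm, hq]; field_simp
  have hqle : q ≤ 4 * (m + 1) / N := by
    rw [hq, div_le_div_iff₀ (by positivity) hN0]
    calc (m + 1) * kappa (m + 1) * N ≤ (m + 1) * (2 * kappa m) * (2 * M) := by
          gcongr
          exact kappa_succ_le m
      _ = 4 * (m + 1) * (M * kappa m) := by ring
  have h2m : (m : ℝ) + 1 ≤ 2 ^ m := by exact_mod_cast Nat.lt_two_pow_self (n := m)
  have h8 : 4 * ((m : ℝ) + 1) ≤ 8 ^ m := by
    calc 4 * ((m : ℝ) + 1) ≤ 4 ^ m * 2 ^ m := by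
          gcongr
          exact le_self_pow₀ (by norm_num) (by omega)
      _ = 8 ^ m := by rw [← mul_pow]; norm_num
  -- The `m`-th root absorbs the factor `4 (m + 1) ≤ 8ᵐ`, which is why the constant is absolute.
  have hw8 : w₀ ≤ 8 * (N : ℝ) ^ (-(1 : ℝ) / m) := by
    refine le_of_pow_le_pow_left₀ (n := m) (by omega) (by positivity) ?_
    rw [hwm, mul_pow, ← Real.rpow_mul_natCast hN0.le, div_mul_cancel₀ _ hm0.ne', Real.rpow_neg_one,
      ← div_eq_mul_inv]
    exact hqle.trans (by gcongr)
  have hw2 : w₀ ≤ 1 / 2 := by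
    refine le_of_pow_le_pow_left₀ (n := m) (by omega) (by norm_num) ?_
    rw [hwm]
    refine hqle.trans ?_
    rw [div_le_iff₀ hN0]
    calc 4 * ((m : ℝ) + 1) ≤ 10 * 5 ^ m := by
          gcongr
          · norm_num
          · exact h2m.trans (by gcongr; norm_num)
      _ = (1 / 2) ^ m * 10 ^ (m + 1) := by
        rw [pow_succ (10 : ℝ), ← mul_assoc, ← mul_pow, mul_comm]; norm_num
      _ ≤ (1 / 2) ^ m * N := by gcongr
  obtain ⟨P, hP, hle⟩ := exists_polytope hm hM1 hM.le hw hw2 hcal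
  refine ⟨P, hP, hle.trans ?_⟩
  have hsq : w₀ ^ 2 ≤ 64 * (N : ℝ) ^ (-(2 : ℝ) / m) := by
    calc w₀ ^ 2 ≤ (8 * (N : ℝ) ^ (-(1 : ℝ) / m)) ^ 2 := by gcongr
      _ = 64 * (N : ℝ) ^ (-(2 : ℝ) / m) := by
        rw [mul_pow, ← Real.rpow_mul_natCast hN0.le]
        norm_num
        ring_nf
  have hNp : 0 ≤ (N : ℝ) ^ (-(2 : ℝ) / m) := by positivity
  exact mul_le_mul_of_nonneg_right (by linarith) hk1.le

end BallApprox


theorem mainTheorem2 :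
    ∃ C : ℝ, 0 < C ∧ ∀ n N : ℕ, 2 ≤ n → 10 ^ n ≤ N →
      (∃ P : Set (EuclideanSpace ℝ (Fin n)), BallApprox.IsPolytopeWithFacetsLE N P ∧
        BallApprox.symmVolDiff (BallApprox.unitBall n) P ≤
          C * (N : ℝ) ^ (-(2 : ℝ) / ((n : ℝ) - 1)) *
            MeasureTheory.volume.real (BallApprox.unitBall n)) ∧
      ∀ P : Set (EuclideanSpace ℝ (Fin n)), BallApprox.IsBestApproximating N P →
        BallApprox.symmVolDiff (BallApprox.unitBall n) P ≤
          C * (N : ℝ) ^ (-(2 : ℝ) / ((n : ℝ) - 1)) *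
            MeasureTheory.volume.real (BallApprox.unitBall n) := by
  refine ⟨10 ^ 7, by norm_num, fun n N hn hN => ?_⟩
  obtain ⟨m, rfl⟩ : ∃ m, n = m + 1 := ⟨n - 1, by omega⟩
  obtain ⟨P, hP, hle⟩ := BallApprox.exists_approximating_polytope (by omega : 1 ≤ m) hN
  rw [show ((m + 1 : ℕ) : ℝ) - 1 = m by push_cast; ring]
  exact ⟨⟨P, hP, hle⟩, fun Q hQ => (hQ.2 P hP).trans hle⟩
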